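/- A tournamenton is a measurable function $W:[0,1]^2\to[0,1]$ such that $W(x,y)+W(y,x)=1$ for all $(x,y)\in[0,1]^2$; it is regular if $\int_{[0,1]}W(x,y)\,\mathrm{d}y=\frac12$ for almost every $x\in[0,1]$. The homomorphism density of a finite digraph $H$ in $W$ is $$t(H,W)=\int_{[0,1]^{V(H)}}\ \prod_{vw\in E(H)}W(x_v,x_w)\,\mathrm{d}x_{V(H)} .$$ For positive integers $a,b,c$, let $T[a,b,c]$ be the tournament whose vertex set is the disjoint union of three parts $A$, $B$, $C$ with $|A|=a$, $|B|=b$, $|C|=c$, in which all edges between distinct parts are directed from $A$ to $B$, from $B$ to $C$ and from $C$ to $A$, and in which each of the three parts induces a transitive tournament. **Theorem.** Let $a,b,c$ be positive integers with $a+b+c\ge 4$. Every regular tournamenton $W$ satisfies $$t(T[a,b,c],W)\ \ge\ 2^{-\binom{a+b+c}{2}},$$ and equality holds if and only if $W=\frac12$ almost everywhere on $[0,1]^2$. -/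

import Mathlib

open MeasureTheory

/-- A tournamenton: a (Lebesgue) measurable function `W : [0,1]² → [0,1]` such that
`W(x,y) + W(y,x) = 1` for all `(x,y) ∈ [0,1]²`.  Being `AEMeasurable` for the Lebesgue measure is
the same as being Lebesgue measurable; in particular Borel measurable functions are covered. -/
structure Tournamenton where
  toFun : unitInterval → unitInterval → ℝ
  aemeasurable' :
    AEMeasurable (fun p : unitInterval × unitInterval => toFun p.1 p.2) volume
  mem_Icc' : ∀ x y, toFun x y ∈ Set.Icc (0 : ℝ) 1
  add_swap' : ∀ x y, toFun x y + toFun y x = 1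

instance : CoeFun Tournamenton (fun _ => unitInterval → unitInterval → ℝ) :=
  ⟨Tournamenton.toFun⟩

/-- A tournamenton is regular if `∫ W(x,y) dy = 1/2` for almost every `x ∈ [0,1]`. -/
def Tournamenton.IsRegular (W : Tournamenton) : Prop :=
  ∀ᵐ x : unitInterval, ∫ y : unitInterval, W x y = 1 / 2

open Classical in
/-- The homomorphism density `t(H,W) = ∫ ∏_{vw ∈ E(H)} W(x_v,x_w) dx_{V(H)}` of a finite digraph
`H`, the integral being over `[0,1]^{V(H)}`. -/
noncomputable def Tournamenton.homDensity {V : Type*} [Fintype V] (H : Digraph V)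
    (W : Tournamenton) : ℝ :=
  ∫ x : V → unitInterval,
    ∏ e ∈ (Finset.univ : Finset (V × V)).filter (fun e => H.Adj e.1 e.2), W (x e.1) (x e.2)

/-- The digraph `C[a,b,c]`: the blow-up of the cyclically oriented triangle whose three parts are
independent and have `a`, `b` and `c` vertices.  All edges are directed from the `a`-part to the
`b`-part, from the `b`-part to the `c`-part, and from the `c`-part to the `a`-part. -/
def cyclicBlowup (a b c : ℕ) : Digraph (Fin a ⊕ Fin b ⊕ Fin c) where
  Adj
    | .inl _, .inr (.inl _) => True
    | .inr (.inl _), .inr (.inr _) => True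
    | .inr (.inr _), .inl _ => True
    | _, _ => False

/-- The disjoint union of transitive tournaments on the three parts. -/
def transitiveParts (a b c : ℕ) : Digraph (Fin a ⊕ Fin b ⊕ Fin c) where
  Adj
    | .inl i, .inl j => i < j
    | .inr (.inl i), .inr (.inl j) => i < j
    | .inr (.inr i), .inr (.inr j) => i < j
    | _, _ => False

/-- The tournament `T[a,b,c]`: the digraph `C[a,b,c]` with a transitive tournament added on each
of its three parts (`⊔` is the union of the edge sets). -/
def cyclicBlowupTournament (a b c : ℕ) : Digraph (Fin a ⊕ Fin b ⊕ Fin c) :=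
  cyclicBlowup a b c ⊔ transitiveParts a b c

/-! ### Real inequalities -/

/-! The edges inside the parts are discarded first. For fixed vertices in the other two parts, all
vertices of one part carry the same weight `w`. The identity `W x y + W y x = 1` makes the
`w`-average of the `w`-weighted out-degree exactly half of its maximum, so Jensen and induction show
that transitive tournaments cost at most the random factor (`pow_le_integral_transWeight`). It
remains to bound the density of `C[a,b,c]`, where by rotation the `a`-part may be assumed to have at
least two vertices.

Let `d(y,z)` be the density of paths `z → x → y`. Regularity gives `d(y,z) = 1/2 - ∫ W x y * W x z`,
which is symmetric, so weighting a power of `d` by `W y z` just halves its integral. The mean of `d`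
is `1/4`; put `Δ = 4^a ∫ d^a`. By convexity `Δ ≥ 16 ∫ d^2 ≥ 1`.

Fix the `a`-part `x`. The common out-neighbours and common in-neighbours of `x` have masses `D` and
`E`, and `P` is the edge mass between them. The weighted Sidorenko inequality for complete bipartite
graphs bounds the count `K` of extensions of `x` from below by a monomial in `P`, `1/D`, `1/E`.
Weighted AM-GM turns it into a linear bound; with everything normalised to be `1` at `W = 1/2`, it
reads `b c P ≤ K + (b-1)(c-1) D E + (c-1) D + (b-1) E`. Over `x`, both `P` and `D E` average to `Δ`,
and `D`, `E` average to `1`. Hence `K` averages to at least `Δ + (b+c-2)(Δ-1) ≥ Δ ≥ 16 ∫ d^2 ≥ 1`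
(`integral_codegree_sq_le_cyclicIntegral`).

Equality forces `∫ d^2 = 1/16`, so `d = 1/4` almost everywhere. A second moment argument then shows
that `W` has the integral of `1/2` over every rectangle (`ae_eq_half_of_integral_codegree_sq`). For
`a = b = c = 1` only `∫ d` appears, which is the same for every regular kernel; this is why four
vertices are needed. -/

theorem pow_tangent_le {p q : ℝ} (hp : 0 ≤ p) (hq : 0 ≤ q) (k : ℕ) :
    q ^ (k + 1) + (k + 1) * q ^ k * (p - q) ≤ p ^ (k + 1) := by
  induction k with
  | zero => simp
  | succ k ih =>
    have h1 : p * (q ^ (k + 1) + (k + 1) * q ^ k * (p - q)) ≤ p * p ^ (k + 1) :=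
      mul_le_mul_of_nonneg_left ih hp
    have h2 : 0 ≤ (k + 1) * q ^ k * (p - q) ^ 2 := by positivity
    have h3 : p * (q ^ (k + 1) + (k + 1) * q ^ k * (p - q)) -
        (q ^ (k + 1 + 1) + ((k + 1 : ℕ) + 1) * q ^ (k + 1) * (p - q)) =
        (k + 1) * q ^ k * (p - q) ^ 2 := by push_cast; ring
    have h4 : p * p ^ (k + 1) = p ^ (k + 1 + 1) := by ring
    linarith

/-- The left side is `t ^ 2 + k * (t - 1)`. When `t` has mean `1`, integrating shows that every
higher moment of `t` is at least the second. -/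
theorem one_add_mul_add_sq_le_pow {t : ℝ} (ht : 0 ≤ t) (k : ℕ) :
    1 + (k + 2) * (t - 1) + (t - 1) ^ 2 ≤ t ^ (k + 2) := by
  induction k with
  | zero => norm_num; nlinarith
  | succ k ih =>
    have h1 := mul_le_mul_of_nonneg_left ih ht
    have h2 : t * t ^ (k + 2) = t ^ (k + 1 + 2) := by ring
    have h3 : 0 ≤ ((k : ℝ) + 1 + t) * (t - 1) ^ 2 := by positivity
    rw [← h2]; push_cast; nlinarith

/-- A weighted AM-GM inequality with total weight `(b + 1) * (c + 1)`. -/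
theorem amgm_of_pow_le {b c : ℕ} {p d e K : ℝ} (hp : 0 ≤ p) (hd : 0 < d) (he : 0 < e) (hK : 0 ≤ K)
    (h : p ^ ((b + 1) * (c + 1)) * d ^ (b + 1) * e ^ (c + 1) ≤
      d ^ ((b + 1) * (c + 1)) * e ^ ((b + 1) * (c + 1)) * K) :
    (b + 1) * (c + 1) * p ≤ K + b * c * (d * e) + c * d + b * e := by
  set m : ℕ := (b + 1) * (c + 1) with hm
  have hm0 : m ≠ 0 := by positivity
  have hmR : (m : ℝ) = (b + 1) * (c + 1) := by push_cast [hm]; ring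
  have hmpos : (0 : ℝ) < m := by positivity
  -- Dividing by `d ^ (b + 1) * e ^ (c + 1)` leaves `m = 1 + b * c + c + b` factors on the right,
  -- which are the four AM-GM weights.
  have key : p ^ m ≤ K * (d * e) ^ (b * c) * d ^ c * e ^ b := by
    have hde : 0 < d ^ (b + 1) * e ^ (c + 1) := by positivity
    refine le_of_mul_le_mul_right ?_ hde
    calc p ^ m * (d ^ (b + 1) * e ^ (c + 1)) = p ^ m * d ^ (b + 1) * e ^ (c + 1) := by ring
      _ ≤ _ := h
      _ = _ := by rw [hm]; ring
  have h2 := Real.geom_mean_le_arith_mean4_weighted (w₁ := 1 / m) (w₂ := b * c / m) (w₃ := c / m)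
    (w₄ := b / m) (by positivity) (by positivity) (by positivity) (by positivity) hK
    (mul_pos hd he).le hd.le he.le (by rw [hmR]; field_simp; ring)
  have h3 : p ≤ K ^ (1 / m : ℝ) * (d * e) ^ (b * c / m : ℝ) * d ^ (c / m : ℝ) *
      e ^ (b / m : ℝ) := by
    have e1 : (d * e) ^ (b * c / m : ℝ) = ((d * e) ^ (b * c)) ^ (1 / m : ℝ) := by
      rw [← Real.rpow_natCast, ← Real.rpow_mul (by positivity)]; push_cast; congr 1; ring
    have e2 : d ^ (c / m : ℝ) = (d ^ c) ^ (1 / m : ℝ) := by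
      rw [← Real.rpow_natCast, ← Real.rpow_mul (by positivity)]; congr 1; ring
    have e3 : e ^ (b / m : ℝ) = (e ^ b) ^ (1 / m : ℝ) := by
      rw [← Real.rpow_natCast, ← Real.rpow_mul (by positivity)]; congr 1; ring
    rw [e1, e2, e3, ← Real.mul_rpow hK (by positivity), ← Real.mul_rpow (by positivity)
      (by positivity), ← Real.mul_rpow (by positivity) (by positivity)]
    calc p = (p ^ m) ^ (1 / m : ℝ) := by rw [one_div, Real.pow_rpow_inv_natCast hp hm0]
      _ ≤ _ := Real.rpow_le_rpow (by positivity) key (by positivity)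
  have h4 := h3.trans h2
  rw [← hmR]
  calc (m : ℝ) * p ≤ m * (1 / m * K + b * c / m * (d * e) + c / m * d + b / m * e) := by gcongr
    _ = _ := by field_simp

/-! ### Measurable functions with values in the unit interval -/

/-- Measurable functions with values in `[0,1]`. -/
structure UnitMeasurable {α : Type*} [MeasurableSpace α] (f : α → ℝ) : Prop where
  measurable : Measurable f
  nonneg : ∀ x, 0 ≤ f x
  le_one : ∀ x, f x ≤ 1

namespace UnitMeasurable

variable {α β : Type*} [MeasurableSpace α] [MeasurableSpace β] {f g : α → ℝ}

theorem const {r : ℝ} (h0 : 0 ≤ r) (h1 : r ≤ 1) : UnitMeasurable (fun _ : α => r) :=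
  ⟨measurable_const, fun _ => h0, fun _ => h1⟩

theorem mul (hf : UnitMeasurable f) (hg : UnitMeasurable g) :
    UnitMeasurable (fun x => f x * g x) :=
  ⟨hf.measurable.mul hg.measurable, fun x => mul_nonneg (hf.nonneg x) (hg.nonneg x),
    fun x => mul_le_one₀ (hf.le_one x) (hg.nonneg x) (hg.le_one x)⟩

theorem pow (hf : UnitMeasurable f) (n : ℕ) : UnitMeasurable (fun x => f x ^ n) :=
  ⟨hf.measurable.pow_const n, fun x => pow_nonneg (hf.nonneg x) n,
    fun x => pow_le_one₀ (hf.nonneg x) (hf.le_one x)⟩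

theorem prod {ι : Type*} {s : Finset ι} {f : ι → α → ℝ} (hf : ∀ i, UnitMeasurable (f i)) :
    UnitMeasurable (fun x => ∏ i ∈ s, f i x) :=
  ⟨Finset.measurable_fun_prod s fun i _ => (hf i).measurable,
    fun x => Finset.prod_nonneg fun i _ => (hf i).nonneg x,
    fun x => Finset.prod_le_one (fun i _ => (hf i).nonneg x) fun i _ => (hf i).le_one x⟩

theorem comp {g : β → α} (hf : UnitMeasurable f) (hg : Measurable g) :
    UnitMeasurable (fun x => f (g x)) :=
  ⟨hf.measurable.comp hg, fun _ => hf.nonneg _, fun _ => hf.le_one _⟩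

theorem integrable (hf : UnitMeasurable f) (μ : Measure α) [IsFiniteMeasure μ] :
    Integrable f μ :=
  Integrable.of_bound hf.measurable.aestronglyMeasurable 1 (.of_forall fun x => by
    rw [Real.norm_of_nonneg (hf.nonneg x)]; exact hf.le_one x)

theorem integral_nonneg (hf : UnitMeasurable f) (μ : Measure α) : 0 ≤ ∫ x, f x ∂μ :=
  MeasureTheory.integral_nonneg hf.nonneg

theorem integral_mono {g : α → ℝ} (hf : UnitMeasurable f) (hg : UnitMeasurable g)
    (μ : Measure α) [IsFiniteMeasure μ] (h : ∀ x, f x ≤ g x) : ∫ x, f x ∂μ ≤ ∫ x, g x ∂μ :=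
  MeasureTheory.integral_mono (hf.integrable μ) (hg.integrable μ) h

theorem integral_le_one (hf : UnitMeasurable f) (μ : Measure α) [IsProbabilityMeasure μ] :
    ∫ x, f x ∂μ ≤ 1 := by
  simpa using MeasureTheory.integral_mono (hf.integrable μ) (integrable_const 1) hf.le_one

theorem integral_right {f : α → β → ℝ} (hf : UnitMeasurable (fun p : α × β => f p.1 p.2))
    (ν : Measure β) [IsProbabilityMeasure ν] : UnitMeasurable (fun x => ∫ y, f x y ∂ν) :=
  ⟨hf.measurable.stronglyMeasurable.integral_prod_right'.measurable,
    fun x => (hf.comp measurable_prodMk_left (g := fun y => (x, y))).integral_nonneg ν,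
    fun x => (hf.comp measurable_prodMk_left (g := fun y => (x, y))).integral_le_one ν⟩

theorem left {f : α → β → ℝ} (hf : UnitMeasurable (fun p : α × β => f p.1 p.2)) (x : α) :
    UnitMeasurable (f x) :=
  hf.comp (g := fun y => (x, y)) measurable_prodMk_left

theorem right {f : α → β → ℝ} (hf : UnitMeasurable (fun p : α × β => f p.1 p.2)) (y : β) :
    UnitMeasurable (fun x => f x y) :=
  hf.comp (g := fun x => (x, y)) measurable_prodMk_right

theorem swap {f : α → β → ℝ} (hf : UnitMeasurable (fun p : α × β => f p.1 p.2)) :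
    UnitMeasurable (fun p : β × α => f p.2 p.1) :=
  hf.comp measurable_swap

theorem integral_comm {f : α → β → ℝ} (hf : UnitMeasurable (fun p : α × β => f p.1 p.2))
    (μ : Measure α) (ν : Measure β) [IsProbabilityMeasure μ] [IsProbabilityMeasure ν] :
    ∫ x, ∫ y, f x y ∂ν ∂μ = ∫ y, ∫ x, f x y ∂μ ∂ν :=
  integral_integral_swap (hf.integrable _)

end UnitMeasurable

/-- Jensen's inequality for the powers of `f` under the weight `w`. -/
theorem integral_mul_pow_le {α : Type*} [MeasurableSpace α] {μ : Measure α}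
    [IsProbabilityMeasure μ] {w f : α → ℝ} (hw : UnitMeasurable w) (hf : UnitMeasurable f) (k : ℕ) :
    (∫ x, w x * f x ∂μ) ^ k * ∫ x, w x ∂μ ≤ (∫ x, w x ∂μ) ^ k * ∫ x, w x * f x ^ k ∂μ := by
  cases k with
  | zero => simp
  | succ k =>
  set S := ∫ x, w x ∂μ
  set T := ∫ x, w x * f x ∂μ
  have hS : 0 ≤ S := hw.integral_nonneg μ
  have hT : 0 ≤ T := (hw.mul hf).integral_nonneg μ
  -- Tangent line of the power function at the weighted mean `T / S`, multiplied by `S ^ (k + 1)` so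
  -- that `S = 0` needs no separate treatment. The linear term integrates to zero.
  have hpt : ∀ x, T ^ (k + 1) * w x + (k + 1) * T ^ k * (S * (w x * f x) - T * w x) ≤
      S ^ (k + 1) * (w x * f x ^ (k + 1)) := fun x => by
    have := mul_le_mul_of_nonneg_left
      (pow_tangent_le (mul_nonneg hS (hf.nonneg x)) hT k) (hw.nonneg x)
    rw [mul_pow] at this
    nlinarith
  have i1 := hw.integrable μ
  have i2 := (hw.mul hf).integrable μ
  have i3 := (hw.mul (hf.pow (k + 1))).integrable μ
  have i4 : Integrable (fun x => S * (w x * f x) - T * w x) μ :=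
    (i2.const_mul S).sub (i1.const_mul T)
  have := MeasureTheory.integral_mono ((i1.const_mul (T ^ (k + 1))).add
    (i4.const_mul ((k + 1) * T ^ k))) (i3.const_mul (S ^ (k + 1))) hpt
  simp only [Pi.add_apply] at this
  rw [integral_add (i1.const_mul _) (i4.const_mul _), integral_const_mul, integral_const_mul,
    integral_const_mul, integral_sub (i2.const_mul _) (i1.const_mul _), integral_const_mul,
    integral_const_mul] at this
  change T ^ (k + 1) * S + (k + 1) * T ^ k * (S * T - T * S) ≤ _ at this
  linarith

/-! ### Kernels: weighted transitive tournaments and complete bipartite graphs -/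

variable {Ω : Type*} [MeasurableSpace Ω]

/-- A regular tournament kernel on a probability space. -/
structure IsRegularTournamentKernel (μ : Measure Ω) (W : Ω → Ω → ℝ) : Prop where
  unit : UnitMeasurable (fun p : Ω × Ω => W p.1 p.2)
  add_swap : ∀ x y, W x y + W y x = 1
  regular : ∀ᵐ x ∂μ, ∫ y, W x y ∂μ = 1 / 2

/-- The edge weights of the transitive tournament on the points `x 0, …, x (k - 1)`. -/
def transWeight (W : Ω → Ω → ℝ) {k : ℕ} (x : Fin k → Ω) : ℝ :=
  ∏ i, ∏ j ∈ Finset.Ioi i, W (x i) (x j)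

/-- The edge weights of the complete bipartite graph directed from the points `x` to the
points `y`. -/
def bipWeight (W : Ω → Ω → ℝ) {k l : ℕ} (x : Fin k → Ω) (y : Fin l → Ω) : ℝ :=
  ∏ i, ∏ j, W (x i) (y j)

theorem transWeight_cons {Ω : Type*} (W : Ω → Ω → ℝ) {k : ℕ} (x₀ : Ω) (x : Fin k → Ω) :
    transWeight W (Fin.cons x₀ x : Fin (k + 1) → Ω) = (∏ i, W x₀ (x i)) * transWeight W x := by
  simp [transWeight, Fin.prod_univ_succ, Fin.prod_Ioi_succ]

variable {μ : Measure Ω} [IsProbabilityMeasure μ] {W : Ω → Ω → ℝ}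

theorem UnitMeasurable.kernel_comp
    (hW : UnitMeasurable (fun p : Ω × Ω => W p.1 p.2)) {α : Type*} [MeasurableSpace α] {f g : α → Ω}
    (hf : Measurable f) (hg : Measurable g) : UnitMeasurable (fun t => W (f t) (g t)) :=
  hW.comp (g := fun t => (f t, g t)) (hf.prodMk hg)

theorem UnitMeasurable.comp_transWeight
    (hW : UnitMeasurable (fun p : Ω × Ω => W p.1 p.2)) {k : ℕ} :
    UnitMeasurable (fun x : Fin k → Ω => transWeight W x) :=
  .prod fun _ => .prod fun _ => hW.kernel_comp (by fun_prop) (by fun_prop)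

theorem UnitMeasurable.comp_bipWeight
    (hW : UnitMeasurable (fun p : Ω × Ω => W p.1 p.2)) {α : Type*} [MeasurableSpace α] {k l : ℕ} {f : α → Fin k → Ω}
    {g : α → Fin l → Ω} (hf : Measurable f) (hg : Measurable g) :
    UnitMeasurable (fun t => bipWeight W (f t) (g t)) :=
  .prod fun _ => .prod fun _ => hW.kernel_comp (by fun_prop) (by fun_prop)

theorem UnitMeasurable.prod_eval {f : Ω → ℝ} (hf : UnitMeasurable f) {k : ℕ} :
    UnitMeasurable (fun x : Fin k → Ω => ∏ i, f (x i)) :=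
  .prod fun i => hf.comp (measurable_pi_apply i)

theorem integral_prod_eval (f : Ω → ℝ) (k : ℕ) :
    ∫ x : Fin k → Ω, ∏ i, f (x i) ∂Measure.pi (fun _ => μ) = (∫ x, f x ∂μ) ^ k := by
  simpa using integral_fintype_prod_eq_pow (ι := Fin k) (μ := μ) f

theorem integral_pi_succ {k : ℕ} {F : (Fin (k + 1) → Ω) → ℝ} (hF : UnitMeasurable F) :
    ∫ x, F x ∂Measure.pi (fun _ => μ) =
      ∫ x₀, ∫ x : Fin k → Ω, F (Fin.cons x₀ x) ∂Measure.pi (fun _ => μ) ∂μ := by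
  have h := (measurePreserving_piFinSuccAbove (fun _ : Fin (k + 1) => μ) 0).symm
  rw [← h.integral_comp', integral_prod]
  · simp [MeasurableEquiv.piFinSuccAbove_symm_apply, Fin.insertNthEquiv_zero, Fin.consEquiv]
  · exact (hF.comp (MeasurableEquiv.piFinSuccAbove (fun _ => Ω) 0).symm.measurable).integrable _

/-- Under any weight, transitive tournaments are at least as frequent as in a random tournament. -/
theorem pow_le_integral_transWeight (hW : UnitMeasurable (fun p : Ω × Ω => W p.1 p.2))
    (hs : ∀ x y, W x y + W y x = 1) (k : ℕ) {w : Ω → ℝ} (hw : UnitMeasurable w) :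
    (1 / 2) ^ k.choose 2 * (∫ x, w x ∂μ) ^ k ≤
      ∫ x : Fin k → Ω, (∏ i, w (x i)) * transWeight W x ∂Measure.pi (fun _ => μ) := by
  induction k generalizing w with
  | zero => simp [transWeight]
  | succ k ih =>
    rw [integral_pi_succ (hw.prod_eval.mul hW.comp_transWeight)]
    have hwW : UnitMeasurable (fun p : Ω × Ω => w p.2 * W p.1 p.2) :=
      (hw.comp measurable_snd).mul hW
    have hf : UnitMeasurable (fun x => ∫ y, w y * W x y ∂μ) :=
      UnitMeasurable.integral_right (f := fun x y => w y * W x y) hwW μ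
    set f := fun x => ∫ y, w y * W x y ∂μ with hfdef
    set S := ∫ x, w x ∂μ with hSdef
    have hS : 0 ≤ S := hw.integral_nonneg μ
    -- Exchanging `x` and `y` replaces `W x y` by `W y x`, and the two integrals add up to `S ^ 2`.
    have hhalf : ∫ x, w x * f x ∂μ = S ^ 2 / 2 := by
      have e1 : ∫ x, w x * f x ∂μ = ∫ x, ∫ y, w x * w y * W x y ∂μ ∂μ := by
        simp_rw [hfdef, ← integral_const_mul, mul_assoc]
      have hu : UnitMeasurable (fun p : Ω × Ω => w p.1 * w p.2 * W p.1 p.2) :=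
        ((hw.comp measurable_fst).mul (hw.comp measurable_snd)).mul hW
      have e2 : ∫ x, ∫ y, w x * w y * W x y ∂μ ∂μ = ∫ x, ∫ y, w x * w y * W y x ∂μ ∂μ := by
        rw [UnitMeasurable.integral_comm (f := fun x y => w x * w y * W x y) hu]
        simp_rw [mul_comm (w _) (w _)]
      have hu' : UnitMeasurable (fun p : Ω × Ω => w p.1 * w p.2 * W p.2 p.1) :=
        ((hw.comp measurable_fst).mul (hw.comp measurable_snd)).mul hW.swap
      have e3 : (∫ x, ∫ y, w x * w y * W x y ∂μ ∂μ) + ∫ x, ∫ y, w x * w y * W y x ∂μ ∂μ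
          = S ^ 2 := by
        rw [← integral_add ((UnitMeasurable.integral_right
            (f := fun x y => w x * w y * W x y) hu μ).integrable μ)
          ((UnitMeasurable.integral_right (f := fun x y => w x * w y * W y x) hu' μ).integrable μ)]
        have : ∀ x, (∫ y, w x * w y * W x y ∂μ) + ∫ y, w x * w y * W y x ∂μ = w x * S := by
          intro x
          rw [← integral_add ((UnitMeasurable.left (f := fun x y => w x * w y * W x y)
              hu x).integrable μ)
            ((UnitMeasurable.left (f := fun x y => w x * w y * W y x) hu' x).integrable μ),
            hSdef, ← integral_const_mul]
          congr 1; ext y; rw [← mul_add, hs, mul_one]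
        simp_rw [this]
        rw [integral_mul_const]; ring
      rw [e1]; linarith
    have hjen := integral_mul_pow_le (μ := μ) hw hf k
    rw [hhalf] at hjen
    have h1 : (1 / 2) ^ k * S ^ (k + 1) ≤ ∫ x, w x * f x ^ k ∂μ := by
      rcases hS.eq_or_lt with h0 | h0
      · rw [← h0]; simpa using (hw.mul (hf.pow k)).integral_nonneg μ
      · refine le_of_mul_le_mul_left ?_ (pow_pos h0 k)
        calc S ^ k * ((1 / 2) ^ k * S ^ (k + 1)) = (S ^ 2 / 2) ^ k * S := by
              rw [div_eq_mul_one_div, mul_pow]; ring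
          _ ≤ _ := hjen
    -- With the source `x₀` fixed, the other vertices form a transitive tournament under the weight
    -- `w y * W x₀ y`; the induction needs arbitrary weights for this.
    have h2 : ∀ x₀, (1 / 2) ^ k.choose 2 * (w x₀ * f x₀ ^ k) ≤
        ∫ x : Fin k → Ω, (∏ i, w ((Fin.cons x₀ x : Fin (k + 1) → Ω) i)) *
          transWeight W (Fin.cons x₀ x : Fin (k + 1) → Ω) ∂Measure.pi (fun _ => μ) := by
      intro x₀
      have e : ∀ x : Fin k → Ω, (∏ i, w ((Fin.cons x₀ x : Fin (k + 1) → Ω) i)) *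
          transWeight W (Fin.cons x₀ x : Fin (k + 1) → Ω) =
          w x₀ * ((∏ i, (w (x i) * W x₀ (x i))) * transWeight W x) := by
        intro x
        rw [transWeight_cons, Fin.prod_univ_succ, Finset.prod_mul_distrib]
        simp only [Fin.cons_zero, Fin.cons_succ]; ring
      simp_rw [e]
      rw [integral_const_mul]
      have := mul_le_mul_of_nonneg_left
        (ih (w := fun y => w y * W x₀ y) (hw.mul (hW.left x₀))) (hw.nonneg x₀)
      calc _ = _ := by ring
        _ ≤ _ := this
    have hR : UnitMeasurable (fun x₀ => ∫ x : Fin k → Ω,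
        (∏ i, w ((Fin.cons x₀ x : Fin (k + 1) → Ω) i)) *
          transWeight W (Fin.cons x₀ x : Fin (k + 1) → Ω) ∂Measure.pi (fun _ => μ)) := by
      refine UnitMeasurable.integral_right (f := fun x₀ (x : Fin k → Ω) =>
        (∏ i, w ((Fin.cons x₀ x : Fin (k + 1) → Ω) i)) *
          transWeight W (Fin.cons x₀ x : Fin (k + 1) → Ω)) ?_ _
      refine (hw.prod_eval.mul hW.comp_transWeight).comp
        (g := fun p : Ω × (Fin k → Ω) => (Fin.cons p.1 p.2 : Fin (k + 1) → Ω)) ?_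
      refine measurable_pi_iff.2 fun i => ?_
      refine Fin.cases ?_ (fun i => ?_) i
      · simpa using measurable_fst
      · simp only [Fin.cons_succ]; fun_prop
    calc (1 / 2) ^ (k + 1).choose 2 * S ^ (k + 1)
        = (1 / 2) ^ k.choose 2 * ((1 / 2) ^ k * S ^ (k + 1)) := by
          rw [Nat.choose_succ_succ' k 1, Nat.choose_one_right, pow_add]; ring
      _ ≤ (1 / 2) ^ k.choose 2 * ∫ x, w x * f x ^ k ∂μ := by gcongr
      _ = ∫ x, (1 / 2) ^ k.choose 2 * (w x * f x ^ k) ∂μ := (integral_const_mul _ _).symm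
      _ ≤ _ := MeasureTheory.integral_mono
          (((hw.mul (hf.pow k)).integrable μ).const_mul _) (hR.integrable μ) h2

/-- The weighted Sidorenko inequality for complete bipartite graphs. -/
theorem pow_mul_pow_mul_pow_le_integral_bipWeight
    (hW : UnitMeasurable (fun p : Ω × Ω => W p.1 p.2))
    {u v : Ω → ℝ} (hu : UnitMeasurable u) (hv : UnitMeasurable v) (b c : ℕ) :
    (∫ y, ∫ z, u y * W y z * v z ∂μ ∂μ) ^ ((b + 1) * (c + 1)) *
        (∫ y, u y ∂μ) ^ (b + 1) * (∫ z, v z ∂μ) ^ (c + 1) ≤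
      (∫ y, u y ∂μ) ^ ((b + 1) * (c + 1)) * (∫ z, v z ∂μ) ^ ((b + 1) * (c + 1)) *
        ∫ y : Fin (b + 1) → Ω, ∫ z : Fin (c + 1) → Ω,
          (∏ j, u (y j)) * bipWeight W y z * (∏ l, v (z l))
          ∂Measure.pi (fun _ => μ) ∂Measure.pi (fun _ => μ) := by
  have hvW : UnitMeasurable (fun p : (Fin (b + 1) → Ω) × Ω => v p.2 * ∏ j, W (p.1 j) p.2) :=
    (hv.comp measurable_snd).mul (.prod fun _ => hW.kernel_comp (by fun_prop) measurable_snd)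
  have hF : UnitMeasurable (fun y : Fin (b + 1) → Ω => ∫ z, v z * ∏ j, W (y j) z ∂μ) :=
    UnitMeasurable.integral_right (f := fun (y : Fin (b + 1) → Ω) z => v z * ∏ j, W (y j) z) hvW μ
  have huW : UnitMeasurable (fun p : Ω × Ω => u p.2 * W p.2 p.1) :=
    (hu.comp measurable_snd).mul hW.swap
  have hG : UnitMeasurable (fun z => ∫ y, u y * W y z ∂μ) :=
    UnitMeasurable.integral_right (f := fun z y => u y * W y z) huW μ
  -- Given `y`, the coordinates of `z` are independent, so the inner integral is a power. Jensen
  -- then applies twice: to this power over `y`, and, after exchanging integrals, to the power of `∫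
  -- y, u y * W y z` over `z`.
  have hK : ∀ y : Fin (b + 1) → Ω, ∫ z : Fin (c + 1) → Ω,
      (∏ j, u (y j)) * bipWeight W y z * (∏ l, v (z l)) ∂Measure.pi (fun _ => μ) =
      (∏ j, u (y j)) * (∫ z, v z * ∏ j, W (y j) z ∂μ) ^ (c + 1) := by
    intro y
    rw [← integral_prod_eval, ← integral_const_mul]
    congr 1; ext z
    rw [bipWeight, Finset.prod_comm, Finset.prod_mul_distrib]; ring
  have hP : ∫ y, ∫ z, u y * W y z * v z ∂μ ∂μ = ∫ z, v z * ∫ y, u y * W y z ∂μ ∂μ := by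
    rw [UnitMeasurable.integral_comm (f := fun y z => u y * W y z * v z)
      (((hu.comp measurable_fst).mul hW).mul (hv.comp measurable_snd))]
    congr 1; ext z; rw [integral_mul_const, mul_comm]
  have hQ : ∫ y : Fin (b + 1) → Ω, (∏ j, u (y j)) * ∫ z, v z * ∏ j, W (y j) z ∂μ
      ∂Measure.pi (fun _ => μ) = ∫ z, v z * (∫ y, u y * W y z ∂μ) ^ (b + 1) ∂μ := by
    simp_rw [← integral_const_mul]
    rw [UnitMeasurable.integral_comm
      (f := fun (y : Fin (b + 1) → Ω) z => (∏ j, u (y j)) * (v z * ∏ j, W (y j) z))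
      ((hu.prod_eval.comp measurable_fst).mul hvW)]
    congr 1; ext z
    rw [← integral_prod_eval, ← integral_const_mul]
    congr 1; ext y
    rw [Finset.prod_mul_distrib]; ring
  have j1 := integral_mul_pow_le (μ := Measure.pi (fun _ : Fin (b + 1) => μ)) hu.prod_eval hF
    (c + 1)
  have j2 := integral_mul_pow_le (μ := μ) hv hG (b + 1)
  rw [integral_prod_eval, hQ] at j1
  simp_rw [hK]
  rw [hP]
  set d := ∫ y, u y ∂μ
  set e := ∫ z, v z ∂μ
  set K := ∫ y : Fin (b + 1) → Ω, (∏ j, u (y j)) * (∫ z, v z * ∏ j, W (y j) z ∂μ) ^ (c + 1)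
    ∂Measure.pi (fun _ => μ)
  set P := ∫ z, v z * ∫ y, u y * W y z ∂μ ∂μ
  set Q := ∫ z, v z * (∫ y, u y * W y z ∂μ) ^ (b + 1) ∂μ
  have hd : 0 ≤ d := hu.integral_nonneg μ
  have he : 0 ≤ e := hv.integral_nonneg μ
  have hP0 : 0 ≤ P := (hv.mul hG).integral_nonneg μ
  calc P ^ ((b + 1) * (c + 1)) * d ^ (b + 1) * e ^ (c + 1)
      = (P ^ (b + 1) * e) ^ (c + 1) * d ^ (b + 1) := by rw [mul_pow, ← pow_mul]; ring
    _ ≤ (e ^ (b + 1) * Q) ^ (c + 1) * d ^ (b + 1) := by gcongr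
    _ = e ^ ((b + 1) * (c + 1)) * (Q ^ (c + 1) * d ^ (b + 1)) := by rw [mul_pow, ← pow_mul]; ring
    _ ≤ e ^ ((b + 1) * (c + 1)) * ((d ^ (b + 1)) ^ (c + 1) * K) := by gcongr
    _ = _ := by rw [← pow_mul]; ring

/-- The iterated integral of the edge weights of a blown-up cyclic triangle, with an additional
weight for each of the three parts. -/
noncomputable def cyclicIntegral (μ : Measure Ω) (W : Ω → Ω → ℝ) {a b c : ℕ}
    (α : (Fin a → Ω) → ℝ) (β : (Fin b → Ω) → ℝ) (γ : (Fin c → Ω) → ℝ) : ℝ :=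
  ∫ x, ∫ y, ∫ z, α x * β y * γ z * (bipWeight W x y * bipWeight W y z * bipWeight W z x)
    ∂Measure.pi (fun _ => μ) ∂Measure.pi (fun _ => μ) ∂Measure.pi (fun _ => μ)

/-! ### Cyclic blow-ups: discarding the edges inside the parts -/

theorem integral_rotate {X Y Z : Type*} [MeasurableSpace X] [MeasurableSpace Y] [MeasurableSpace Z]
    {μX : Measure X} {μY : Measure Y} {μZ : Measure Z} [IsProbabilityMeasure μX]
    [IsProbabilityMeasure μY] [IsProbabilityMeasure μZ] {F : X → Y → Z → ℝ}
    (hF : UnitMeasurable (fun p : X × Y × Z => F p.1 p.2.1 p.2.2)) :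
    ∫ x, ∫ y, ∫ z, F x y z ∂μZ ∂μY ∂μX = ∫ y, ∫ z, ∫ x, F x y z ∂μX ∂μZ ∂μY := by
  have h1 : UnitMeasurable (fun p : X × Y => ∫ z, F p.1 p.2 z ∂μZ) :=
    UnitMeasurable.integral_right (f := fun (p : X × Y) z => F p.1 p.2 z)
      (hF.comp (g := fun p : (X × Y) × Z => (p.1.1, p.1.2, p.2)) (by fun_prop)) μZ
  rw [UnitMeasurable.integral_comm (f := fun x y => ∫ z, F x y z ∂μZ) h1]
  congr 1; ext y
  exact UnitMeasurable.integral_comm (f := fun x z => F x y z)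
    (hF.comp (g := fun p : X × Z => (p.1, y, p.2)) (by fun_prop)) _ _

theorem UnitMeasurable.cyclic_integrand (hW : UnitMeasurable (fun p : Ω × Ω => W p.1 p.2))
    {a b c : ℕ} {α : (Fin a → Ω) → ℝ} {β : (Fin b → Ω) → ℝ} {γ : (Fin c → Ω) → ℝ}
    (hα : UnitMeasurable α) (hβ : UnitMeasurable β) (hγ : UnitMeasurable γ) :
    UnitMeasurable (fun p : (Fin a → Ω) × (Fin b → Ω) × (Fin c → Ω) =>
      α p.1 * β p.2.1 * γ p.2.2 *
        (bipWeight W p.1 p.2.1 * bipWeight W p.2.1 p.2.2 * bipWeight W p.2.2 p.1)) :=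
  (((hα.comp (by fun_prop)).mul (hβ.comp (by fun_prop))).mul (hγ.comp (by fun_prop))).mul
    (((hW.comp_bipWeight (by fun_prop) (by fun_prop)).mul
      (hW.comp_bipWeight (by fun_prop) (by fun_prop))).mul (hW.comp_bipWeight (by fun_prop) (by fun_prop)))

theorem cyclicIntegral_rotate (hW : UnitMeasurable (fun p : Ω × Ω => W p.1 p.2))
    {a b c : ℕ} {α : (Fin a → Ω) → ℝ} {β : (Fin b → Ω) → ℝ} {γ : (Fin c → Ω) → ℝ}
    (hα : UnitMeasurable α) (hβ : UnitMeasurable β) (hγ : UnitMeasurable γ) :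
    cyclicIntegral μ W α β γ = cyclicIntegral μ W β γ α := by
  rw [cyclicIntegral, integral_rotate (F := fun x y z => α x * β y * γ z *
    (bipWeight W x y * bipWeight W y z * bipWeight W z x)) (hW.cyclic_integrand hα hβ hγ)]
  simp only [cyclicIntegral]
  congr 1; ext y; congr 1; ext z; congr 1; ext x
  ring

/-- For fixed `y` and `z`, each vertex `t` of the first part carries the weight `∏ W (z l) t * ∏ W t
(y j)`, and `pow_le_integral_transWeight` applies to it. The weights `β` and `γ` stay arbitrary so
that the three parts can be treated in turn by rotation. -/
theorem le_cyclicIntegral_transWeight (hW : UnitMeasurable (fun p : Ω × Ω => W p.1 p.2))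
    (hs : ∀ x y, W x y + W y x = 1) {a b c : ℕ} {β : (Fin b → Ω) → ℝ} {γ : (Fin c → Ω) → ℝ}
    (hβ : UnitMeasurable β) (hγ : UnitMeasurable γ) :
    (1 / 2) ^ a.choose 2 * cyclicIntegral μ W (fun _ : Fin a → Ω => 1) β γ ≤
      cyclicIntegral μ W (transWeight W : (Fin a → Ω) → ℝ) β γ := by
  have hone : UnitMeasurable (fun _ : Fin a → Ω => (1 : ℝ)) := .const zero_le_one le_rfl
  rw [cyclicIntegral_rotate hW hone hβ hγ, cyclicIntegral_rotate hW hW.comp_transWeight hβ hγ]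
  have u1 := hW.cyclic_integrand hβ hγ hone
  have u2 := hW.cyclic_integrand hβ hγ (hW.comp_transWeight (k := a))
  have v1 := UnitMeasurable.integral_right (f := fun (p : (Fin b → Ω) × (Fin c → Ω))
    (x : Fin a → Ω) => β p.1 * γ p.2 * 1 *
      (bipWeight W p.1 p.2 * bipWeight W p.2 x * bipWeight W x p.1))
    (u1.comp (g := fun q : ((Fin b → Ω) × (Fin c → Ω)) × (Fin a → Ω) => (q.1.1, q.1.2, q.2))
      (by fun_prop)) (Measure.pi (fun _ => μ))
  have v2 := UnitMeasurable.integral_right (f := fun (p : (Fin b → Ω) × (Fin c → Ω))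
    (x : Fin a → Ω) => β p.1 * γ p.2 * transWeight W x *
      (bipWeight W p.1 p.2 * bipWeight W p.2 x * bipWeight W x p.1))
    (u2.comp (g := fun q : ((Fin b → Ω) × (Fin c → Ω)) × (Fin a → Ω) => (q.1.1, q.1.2, q.2))
      (by fun_prop)) (Measure.pi (fun _ => μ))
  simp only [cyclicIntegral]
  rw [← integral_prod (f := fun p : (Fin b → Ω) × (Fin c → Ω) => ∫ x : Fin a → Ω,
      β p.1 * γ p.2 * 1 * (bipWeight W p.1 p.2 * bipWeight W p.2 x * bipWeight W x p.1)
      ∂Measure.pi (fun _ => μ)) (v1.integrable _),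
    ← integral_prod (f := fun p : (Fin b → Ω) × (Fin c → Ω) => ∫ x : Fin a → Ω,
      β p.1 * γ p.2 * transWeight W x *
        (bipWeight W p.1 p.2 * bipWeight W p.2 x * bipWeight W x p.1)
      ∂Measure.pi (fun _ => μ)) (v2.integrable _), ← integral_const_mul]
  refine MeasureTheory.integral_mono ((v1.integrable _).const_mul _) (v2.integrable _) ?_
  rintro ⟨y, z⟩
  have hw : UnitMeasurable (fun t => (∏ l, W (z l) t) * ∏ j, W t (y j)) :=
    .mul (.prod fun l => hW.left _) (.prod fun j => hW.right _)
  have hb : ∀ x : Fin a → Ω, bipWeight W z x * bipWeight W x y =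
      ∏ i, ((∏ l, W (z l) (x i)) * ∏ j, W (x i) (y j)) := fun x => by
    rw [Finset.prod_mul_distrib, bipWeight, bipWeight, Finset.prod_comm]
  have key := pow_le_integral_transWeight (μ := μ) hW hs a hw
  rw [← integral_prod_eval] at key
  have h0 : 0 ≤ β y * γ z * bipWeight W y z :=
    mul_nonneg (mul_nonneg (hβ.nonneg y) (hγ.nonneg z))
      (Finset.prod_nonneg fun _ _ => Finset.prod_nonneg fun _ _ => hW.nonneg (_, _))
  have := mul_le_mul_of_nonneg_left key h0
  dsimp only
  calc _ = β y * γ z * bipWeight W y z * ((1 / 2) ^ a.choose 2 *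
        ∫ x : Fin a → Ω, ∏ i, ((∏ l, W (z l) (x i)) * ∏ j, W (x i) (y j))
          ∂Measure.pi (fun _ => μ)) := by
        rw [mul_left_comm, ← integral_const_mul (β y * γ z * bipWeight W y z)]
        congr 2; ext x; rw [← hb]; ring
    _ ≤ _ := this
    _ = _ := by
        rw [← integral_const_mul]; congr 1; ext x; rw [← hb]; ring

theorem le_cyclicIntegral_transWeight_transWeight_transWeight
    (hW : UnitMeasurable (fun p : Ω × Ω => W p.1 p.2))
    (hs : ∀ x y, W x y + W y x = 1) (a b c : ℕ) :
    (1 / 2) ^ (a.choose 2 + b.choose 2 + c.choose 2) *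
        cyclicIntegral μ W (fun _ : Fin a → Ω => 1) (fun _ : Fin b → Ω => 1)
          (fun _ : Fin c → Ω => 1) ≤
      cyclicIntegral μ W (transWeight W : (Fin a → Ω) → ℝ) (transWeight W : (Fin b → Ω) → ℝ)
        (transWeight W : (Fin c → Ω) → ℝ) := by
  have hone : ∀ k : ℕ, UnitMeasurable (fun _ : Fin k → Ω => (1 : ℝ)) :=
    fun _ => .const zero_le_one le_rfl
  have ht : ∀ k : ℕ, UnitMeasurable (transWeight W : (Fin k → Ω) → ℝ) := fun _ => hW.comp_transWeight
  have h1 := le_cyclicIntegral_transWeight (μ := μ) hW hs (a := a) (ht b) (ht c)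
  have h2 := le_cyclicIntegral_transWeight (μ := μ) hW hs (a := b) (ht c) (hone a)
  have h3 := le_cyclicIntegral_transWeight (μ := μ) hW hs (a := c) (hone a) (hone b)
  rw [cyclicIntegral_rotate hW (hone a) (ht b) (ht c)] at h1
  rw [cyclicIntegral_rotate hW (hone b) (ht c) (hone a)] at h2
  rw [cyclicIntegral_rotate hW (hone c) (hone a) (hone b)] at h3
  calc _ = (1 / 2) ^ a.choose 2 * ((1 / 2) ^ b.choose 2 * ((1 / 2) ^ c.choose 2 *
        cyclicIntegral μ W (fun _ : Fin a → Ω => 1) (fun _ : Fin b → Ω => 1)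
          (fun _ : Fin c → Ω => 1))) := by rw [pow_add, pow_add]; ring
    _ ≤ (1 / 2) ^ a.choose 2 * ((1 / 2) ^ b.choose 2 * _) :=
        mul_le_mul_of_nonneg_left (mul_le_mul_of_nonneg_left h3 (by positivity)) (by positivity)
    _ ≤ (1 / 2) ^ a.choose 2 * _ := mul_le_mul_of_nonneg_left h2 (by positivity)
    _ ≤ _ := h1

/-! ### Codegrees -/

/-- The number `∫ W z x * W x y` of directed paths of length two from `z` to `y` in a regular
tournament kernel, in a form that is symmetric everywhere: see `integral_mul_eq_codegree`. -/
noncomputable def codegree (μ : Measure Ω) (W : Ω → Ω → ℝ) (y z : Ω) : ℝ :=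
  |1 / 2 - ∫ x, W x y * W x z ∂μ|

theorem codegree_comm {Ω : Type*} [MeasurableSpace Ω] {μ : Measure Ω} {W : Ω → Ω → ℝ} (y z : Ω) : codegree μ W y z = codegree μ W z y := by
  simp only [codegree, mul_comm]

namespace IsRegularTournamentKernel

theorem regular_swap (h : IsRegularTournamentKernel μ W) :
    ∀ᵐ y ∂μ, ∫ x, W x y ∂μ = 1 / 2 := by
  filter_upwards [h.regular] with y hy
  have : ∀ x, W x y = 1 - W y x := fun x => by linarith [h.add_swap x y]
  simp_rw [this]
  rw [integral_sub (integrable_const _) ((h.unit.left y).integrable μ), hy]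
  norm_num

theorem unit_common (h : IsRegularTournamentKernel μ W) :
    UnitMeasurable (fun p : Ω × Ω => ∫ x, W x p.1 * W x p.2 ∂μ) :=
  UnitMeasurable.integral_right (f := fun (p : Ω × Ω) x => W x p.1 * W x p.2)
    ((h.unit.kernel_comp (by fun_prop) (by fun_prop)).mul
      (h.unit.kernel_comp (by fun_prop) (by fun_prop))) μ

theorem unit_codegree (h : IsRegularTournamentKernel μ W) :
    UnitMeasurable (fun p : Ω × Ω => codegree μ W p.1 p.2) := by
  have hq := h.unit_common
  refine ⟨(measurable_const.sub hq.measurable).abs, fun _ => abs_nonneg _, fun p => ?_⟩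
  have h0 := hq.nonneg p
  have h1 := hq.le_one p
  exact abs_le.2 ⟨by linarith, by linarith⟩

/-- Substituting `W z x = 1 - W x z` uses regularity at `y` alone, hence the quantifier over all
`z`. The path density is nonnegative, so the absolute value in `codegree` has no effect. -/
theorem integral_mul_eq_codegree (h : IsRegularTournamentKernel μ W) :
    ∀ᵐ y ∂μ, ∀ z, ∫ x, W x y * W z x ∂μ = codegree μ W y z ∧
      codegree μ W y z = 1 / 2 - ∫ x, W x y * W x z ∂μ := by
  filter_upwards [h.regular_swap] with y hy z
  have e : ∀ x, W x y * W z x = W x y - W x y * W x z := fun x => by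
    have := h.add_swap z x
    rw [← eq_sub_iff_add_eq] at this
    rw [this]; ring
  have h1 : ∫ x, W x y * W z x ∂μ = 1 / 2 - ∫ x, W x y * W x z ∂μ := by
    simp_rw [e]
    rw [integral_sub ((h.unit.right y).integrable μ)
      (((h.unit.right y).mul
        (h.unit.right z)).integrable μ), hy]
  have h0 : 0 ≤ ∫ x, W x y * W z x ∂μ :=
    ((h.unit.right y).mul (h.unit.left z)).integral_nonneg μ
  have : codegree μ W y z = 1 / 2 - ∫ x, W x y * W x z ∂μ := abs_of_nonneg (h1 ▸ h0)
  exact ⟨h1.trans this.symm, this⟩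

theorem integral_codegree (h : IsRegularTournamentKernel μ W) :
    ∫ p : Ω × Ω, codegree μ W p.1 p.2 ∂μ.prod μ = 1 / 4 := by
  rw [integral_prod _ (h.unit_codegree.integrable _)]
  have hu : UnitMeasurable (fun p : Ω × Ω × Ω => W p.1 p.2.1 * W p.2.2 p.1) :=
    (h.unit.kernel_comp (by fun_prop) (by fun_prop)).mul
      (h.unit.kernel_comp (by fun_prop) (by fun_prop))
  calc ∫ y, ∫ z, codegree μ W y z ∂μ ∂μ = ∫ y, ∫ z, ∫ x, W x y * W z x ∂μ ∂μ ∂μ := by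
        refine integral_congr_ae ?_
        filter_upwards [h.integral_mul_eq_codegree] with y hy
        simp_rw [(hy _).1]
    _ = ∫ x, ∫ y, ∫ z, W x y * W z x ∂μ ∂μ ∂μ :=
        (integral_rotate (F := fun x y z => W x y * W z x) hu).symm
    _ = ∫ x, 1 / 4 ∂μ := by
        refine integral_congr_ae ?_
        filter_upwards [h.regular, h.regular_swap] with x hx hx'
        simp_rw [integral_const_mul, hx', integral_mul_const, hx]
        norm_num
    _ = _ := by simp

/-- The codegree is symmetric, while `W` and its transpose sum to `1`. -/
theorem integral_mul_codegree_pow (h : IsRegularTournamentKernel μ W) (k : ℕ) :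
    ∫ p : Ω × Ω, W p.1 p.2 * codegree μ W p.1 p.2 ^ k ∂μ.prod μ =
      (∫ p : Ω × Ω, codegree μ W p.1 p.2 ^ k ∂μ.prod μ) / 2 := by
  have u1 := h.unit.mul (h.unit_codegree.pow k)
  have u2 := h.unit.swap.mul (h.unit_codegree.pow k)
  have e1 : ∫ p : Ω × Ω, W p.1 p.2 * codegree μ W p.1 p.2 ^ k ∂μ.prod μ =
      ∫ p : Ω × Ω, W p.2 p.1 * codegree μ W p.1 p.2 ^ k ∂μ.prod μ := by
    rw [← integral_prod_swap]
    simp only [Prod.fst_swap, Prod.snd_swap, codegree_comm]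
  have e2 := integral_add (u1.integrable (μ.prod μ)) (u2.integrable (μ.prod μ))
  simp_rw [← add_mul, h.add_swap, one_mul] at e2
  linarith

theorem integral_codegree_pow_ge (h : IsRegularTournamentKernel μ W) (k : ℕ) :
    16 * ∫ p : Ω × Ω, codegree μ W p.1 p.2 ^ 2 ∂μ.prod μ ≤
      4 ^ (k + 2) * ∫ p : Ω × Ω, codegree μ W p.1 p.2 ^ (k + 2) ∂μ.prod μ := by
  have i1 := h.unit_codegree.integrable (μ.prod μ)
  have i2 := (h.unit_codegree.pow 2).integrable (μ.prod μ)
  have ik := (h.unit_codegree.pow (k + 2)).integrable (μ.prod μ)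
  have i3 : Integrable (fun p : Ω × Ω => 4 * k * codegree μ W p.1 p.2 - k) (μ.prod μ) :=
    (i1.const_mul _).sub (integrable_const _)
  have := MeasureTheory.integral_mono ((i2.const_mul 16).add i3) (ik.const_mul (4 ^ (k + 2)))
    (fun p => by
      have := one_add_mul_add_sq_le_pow (t := 4 * codegree μ W p.1 p.2)
        (mul_nonneg (by norm_num) (h.unit_codegree.nonneg p)) k
      simp only [Pi.add_apply]
      rw [mul_pow] at this
      linarith)
  simp only [Pi.add_apply] at this
  rw [integral_add (i2.const_mul _) i3, integral_sub (i1.const_mul _) (integrable_const _),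
    integral_const_mul, integral_const_mul, integral_const_mul, h.integral_codegree] at this
  simp only [integral_const, probReal_univ, one_smul] at this
  linarith

theorem integral_codegree_sub_sq (h : IsRegularTournamentKernel μ W) :
    ∫ p : Ω × Ω, (4 * codegree μ W p.1 p.2 - 1) ^ 2 ∂μ.prod μ =
      16 * (∫ p : Ω × Ω, codegree μ W p.1 p.2 ^ 2 ∂μ.prod μ) - 1 := by
  have i1 := h.unit_codegree.integrable (μ.prod μ)
  have i2 := (h.unit_codegree.pow 2).integrable (μ.prod μ)
  have i3 : Integrable (fun p : Ω × Ω => 8 * codegree μ W p.1 p.2 - 1) (μ.prod μ) :=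
    (i1.const_mul _).sub (integrable_const _)
  have e : ∀ p : Ω × Ω, (4 * codegree μ W p.1 p.2 - 1) ^ 2 =
      16 * codegree μ W p.1 p.2 ^ 2 - (8 * codegree μ W p.1 p.2 - 1) := fun p => by ring
  simp_rw [e]
  rw [integral_sub (i2.const_mul _) i3, integral_sub (i1.const_mul _) (integrable_const _),
    integral_const_mul, integral_const_mul, h.integral_codegree]
  simp only [integral_const, probReal_univ, one_smul]
  norm_num

end IsRegularTournamentKernel

/-! ### Lower bound for blow-ups with independent parts, and the equality case -/

namespace IsRegularTournamentKernel

theorem integral_outDegree_pow (h : IsRegularTournamentKernel μ W) (a : ℕ) :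
    ∫ x : Fin a → Ω, ∫ y, ∏ i, W (x i) y ∂μ ∂Measure.pi (fun _ => μ) = (1 / 2) ^ a := by
  rw [UnitMeasurable.integral_comm (f := fun (x : Fin a → Ω) y => ∏ i, W (x i) y)
    (.prod fun _ => h.unit.kernel_comp (by fun_prop) (by fun_prop))]
  calc _ = ∫ _ : Ω, (1 / 2 : ℝ) ^ a ∂μ := by
        refine integral_congr_ae ?_
        filter_upwards [h.regular_swap] with y hy
        rw [← hy]
        exact integral_prod_eval (fun x => W x y) a
    _ = _ := by simp

theorem integral_inDegree_pow (h : IsRegularTournamentKernel μ W) (a : ℕ) :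
    ∫ x : Fin a → Ω, ∫ z, ∏ i, W z (x i) ∂μ ∂Measure.pi (fun _ => μ) = (1 / 2) ^ a := by
  rw [UnitMeasurable.integral_comm (f := fun (x : Fin a → Ω) z => ∏ i, W z (x i))
    (.prod fun _ => h.unit.kernel_comp (by fun_prop) (by fun_prop))]
  calc _ = ∫ _ : Ω, (1 / 2 : ℝ) ^ a ∂μ := by
        refine integral_congr_ae ?_
        filter_upwards [h.regular] with z hz
        rw [← hz]
        exact integral_prod_eval (fun x => W z x) a
    _ = _ := by simp

/-- For fixed `y` and `z`, the `a` middle vertices are independent and each contributes a codegree.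
The case `G = W` computes the mean of `P`, the case `G = 1` that of `D * E`. -/
theorem integral_paths (h : IsRegularTournamentKernel μ W) (a : ℕ) {G : Ω → Ω → ℝ}
    (hG : UnitMeasurable (fun p : Ω × Ω => G p.1 p.2)) :
    ∫ x : Fin a → Ω, ∫ y, ∫ z, (∏ i, W (x i) y) * G y z * (∏ i, W z (x i)) ∂μ ∂μ
        ∂Measure.pi (fun _ => μ) =
      ∫ p : Ω × Ω, G p.1 p.2 * codegree μ W p.1 p.2 ^ a ∂μ.prod μ := by
  have hu : UnitMeasurable (fun p : (Fin a → Ω) × Ω × Ω =>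
      (∏ i, W (p.1 i) p.2.1) * G p.2.1 p.2.2 * ∏ i, W p.2.2 (p.1 i)) :=
    ((UnitMeasurable.prod fun _ => h.unit.kernel_comp (by fun_prop) (by fun_prop)).mul
      (hG.kernel_comp (by fun_prop) (by fun_prop))).mul
      (.prod fun _ => h.unit.kernel_comp (by fun_prop) (by fun_prop))
  rw [integral_rotate (F := fun (x : Fin a → Ω) y z =>
    (∏ i, W (x i) y) * G y z * ∏ i, W z (x i)) hu,
    integral_prod _ ((hG.mul (h.unit_codegree.pow a)).integrable _)]
  refine integral_congr_ae ?_
  filter_upwards [h.integral_mul_eq_codegree] with y hy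
  congr 1; ext z
  rw [← (hy z).1, ← integral_prod_eval, ← integral_const_mul]
  congr 1; ext x
  rw [Finset.prod_mul_distrib]; ring

theorem one_le_integral_codegree_sq (h : IsRegularTournamentKernel μ W) :
    1 ≤ 16 * ∫ p : Ω × Ω, codegree μ W p.1 p.2 ^ 2 ∂μ.prod μ := by
  have h3 := h.integral_codegree_sub_sq
  have : 0 ≤ ∫ p : Ω × Ω, (4 * codegree μ W p.1 p.2 - 1) ^ 2 ∂μ.prod μ :=
    integral_nonneg fun _ => sq_nonneg _
  linarith

/-- The density of blown-up cyclic triangles is bounded below by the second moment of the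
codegrees. -/
theorem integral_codegree_sq_le_cyclicIntegral (h : IsRegularTournamentKernel μ W) (k b c : ℕ) :
    16 * ∫ p : Ω × Ω, codegree μ W p.1 p.2 ^ 2 ∂μ.prod μ ≤
      2 ^ ((k + 2) * (b + 1) + (b + 1) * (c + 1) + (c + 1) * (k + 2)) *
        cyclicIntegral μ W (fun _ : Fin (k + 2) → Ω => 1) (fun _ : Fin (b + 1) → Ω => 1)
          (fun _ : Fin (c + 1) → Ω => 1) := by
  have hk := h.integral_codegree_pow_ge k
  generalize k + 2 = a at hk ⊢
  set N := a * (b + 1) + (b + 1) * (c + 1) + (c + 1) * a with hN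
  have uu : UnitMeasurable (fun p : (Fin a → Ω) × Ω => ∏ i, W (p.1 i) p.2) :=
    .prod fun _ => h.unit.kernel_comp (by fun_prop) (by fun_prop)
  have uv : UnitMeasurable (fun p : (Fin a → Ω) × Ω => ∏ i, W p.2 (p.1 i)) :=
    .prod fun _ => h.unit.kernel_comp (by fun_prop) (by fun_prop)
  have hD := h.integral_outDegree_pow a
  have hE := h.integral_inDegree_pow a
  have hP := h.integral_paths a h.unit
  rw [h.integral_mul_codegree_pow] at hP
  have hDE := h.integral_paths a (G := fun _ _ => 1) (.const zero_le_one le_rfl)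
  simp only [one_mul, mul_one] at hDE
  have uD : UnitMeasurable (fun x : Fin a → Ω => ∫ y, ∏ i, W (x i) y ∂μ) :=
    UnitMeasurable.integral_right (f := fun (x : Fin a → Ω) y => ∏ i, W (x i) y) uu μ
  have uE : UnitMeasurable (fun x : Fin a → Ω => ∫ z, ∏ i, W z (x i) ∂μ) :=
    UnitMeasurable.integral_right (f := fun (x : Fin a → Ω) z => ∏ i, W z (x i)) uv μ
  have uP0 : UnitMeasurable (fun p : ((Fin a → Ω) × Ω) × Ω =>
      (∏ i, W (p.1.1 i) p.1.2) * W p.1.2 p.2 * (∏ i, W p.2 (p.1.1 i))) :=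
    ((uu.comp measurable_fst).mul (h.unit.kernel_comp (by fun_prop) (by fun_prop))).mul
      (uv.comp (g := fun p : ((Fin a → Ω) × Ω) × Ω => (p.1.1, p.2)) (by fun_prop))
  have uP1 : UnitMeasurable (fun q : (Fin a → Ω) × Ω => ∫ z,
      (∏ i, W (q.1 i) q.2) * W q.2 z * (∏ i, W z (q.1 i)) ∂μ) :=
    UnitMeasurable.integral_right (f := fun (q : (Fin a → Ω) × Ω) z =>
      (∏ i, W (q.1 i) q.2) * W q.2 z * (∏ i, W z (q.1 i))) uP0 μ
  have uP : UnitMeasurable (fun x : Fin a → Ω => ∫ y, ∫ z,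
      (∏ i, W (x i) y) * W y z * (∏ i, W z (x i)) ∂μ ∂μ) :=
    UnitMeasurable.integral_right (f := fun (x : Fin a → Ω) y => ∫ z,
      (∏ i, W (x i) y) * W y z * (∏ i, W z (x i)) ∂μ) uP1 μ
  have uK0 := h.unit.cyclic_integrand
    (.const zero_le_one le_rfl : UnitMeasurable (fun _ : Fin a → Ω => (1 : ℝ)))
    (.const zero_le_one le_rfl : UnitMeasurable (fun _ : Fin (b + 1) → Ω => (1 : ℝ)))
    (.const zero_le_one le_rfl : UnitMeasurable (fun _ : Fin (c + 1) → Ω => (1 : ℝ)))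
  simp only [one_mul] at uK0
  have uK : UnitMeasurable (fun x : Fin a → Ω => ∫ y : Fin (b + 1) → Ω, ∫ z : Fin (c + 1) → Ω,
      bipWeight W x y * bipWeight W y z * bipWeight W z x
      ∂Measure.pi (fun _ => μ) ∂Measure.pi (fun _ => μ)) :=
    UnitMeasurable.integral_right (f := fun (x : Fin a → Ω) (y : Fin (b + 1) → Ω) =>
      ∫ z : Fin (c + 1) → Ω, bipWeight W x y * bipWeight W y z * bipWeight W z x
      ∂Measure.pi (fun _ => μ))
      (UnitMeasurable.integral_right (f := fun (q : (Fin a → Ω) × (Fin (b + 1) → Ω))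
        (z : Fin (c + 1) → Ω) => bipWeight W q.1 q.2 * bipWeight W q.2 z * bipWeight W z q.1)
        (uK0.comp (g := fun p : ((Fin a → Ω) × (Fin (b + 1) → Ω)) × (Fin (c + 1) → Ω) =>
          (p.1.1, p.1.2, p.2)) (by fun_prop)) _) _
  have hcyc : cyclicIntegral μ W (fun _ : Fin a → Ω => 1) (fun _ : Fin (b + 1) → Ω => 1)
      (fun _ : Fin (c + 1) → Ω => 1) = ∫ x : Fin a → Ω, ∫ y : Fin (b + 1) → Ω,
      ∫ z : Fin (c + 1) → Ω, bipWeight W x y * bipWeight W y z * bipWeight W z x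
      ∂Measure.pi (fun _ => μ) ∂Measure.pi (fun _ => μ) ∂Measure.pi (fun _ => μ) := by
    simp only [cyclicIntegral, one_mul]
  have hDE' : ∫ x : Fin a → Ω, (∫ y, ∏ i, W (x i) y ∂μ) * ∫ z, ∏ i, W z (x i) ∂μ
      ∂Measure.pi (fun _ => μ) = ∫ p : Ω × Ω, codegree μ W p.1 p.2 ^ a ∂μ.prod μ := by
    rw [← hDE]
    simp_rw [integral_const_mul, integral_mul_const]
  -- Sidorenko and AM-GM for fixed `x`. Each power of two normalises its integral to `1` at the
  -- constant kernel `1 / 2`.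
  have hpt : ∀ x : Fin a → Ω,
      ((b : ℝ) + 1) * (c + 1) * (2 * 4 ^ a *
          ∫ y, ∫ z, (∏ i, W (x i) y) * W y z * (∏ i, W z (x i)) ∂μ ∂μ) ≤
      2 ^ N * (∫ y : Fin (b + 1) → Ω, ∫ z : Fin (c + 1) → Ω,
        bipWeight W x y * bipWeight W y z * bipWeight W z x
        ∂Measure.pi (fun _ => μ) ∂Measure.pi (fun _ => μ)) +
      (b * c * 4 ^ a * ((∫ y, ∏ i, W (x i) y ∂μ) * ∫ z, ∏ i, W z (x i) ∂μ) +
      (c * 2 ^ a * (∫ y, ∏ i, W (x i) y ∂μ) + b * 2 ^ a * ∫ z, ∏ i, W z (x i) ∂μ)) := by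
    intro x
    have key := pow_mul_pow_mul_pow_le_integral_bipWeight (μ := μ) h.unit
      (UnitMeasurable.left (f := fun (x : Fin a → Ω) y => ∏ i, W (x i) y) uu x)
      (UnitMeasurable.left (f := fun (x : Fin a → Ω) z => ∏ i, W z (x i)) uv x) b c
    have hb : ∀ (y : Fin (b + 1) → Ω) (z : Fin (c + 1) → Ω),
        (∏ j, ∏ i, W (x i) (y j)) * bipWeight W y z * (∏ l, ∏ i, W (z l) (x i)) =
        bipWeight W x y * bipWeight W y z * bipWeight W z x := fun y z => by
      rw [Finset.prod_comm]; rfl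
    simp_rw [hb] at key
    have hPD : ∫ y, ∫ z, (∏ i, W (x i) y) * W y z * (∏ i, W z (x i)) ∂μ ∂μ ≤
        ∫ y, ∏ i, W (x i) y ∂μ := by
      refine (UnitMeasurable.left (f := fun (x : Fin a → Ω) y => ∫ z,
        (∏ i, W (x i) y) * W y z * (∏ i, W z (x i)) ∂μ) uP1 x).integral_mono
        (UnitMeasurable.left (f := fun (x : Fin a → Ω) y => ∏ i, W (x i) y) uu x) μ fun y => ?_
      simp_rw [mul_assoc, integral_const_mul]
      exact mul_le_of_le_one_right (uu.nonneg (x, y)) (((h.unit.left y).mul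
        (UnitMeasurable.left (f := fun (x : Fin a → Ω) z => ∏ i, W z (x i)) uv x)).integral_le_one μ)
    have hPE : ∫ y, ∫ z, (∏ i, W (x i) y) * W y z * (∏ i, W z (x i)) ∂μ ∂μ ≤
        ∫ z, ∏ i, W z (x i) ∂μ := by
      calc _ ≤ ∫ _ : Ω, ∫ z, ∏ i, W z (x i) ∂μ ∂μ := by
            refine (UnitMeasurable.left (f := fun (x : Fin a → Ω) y => ∫ z,
              (∏ i, W (x i) y) * W y z * (∏ i, W z (x i)) ∂μ) uP1 x).integral_mono
              (.const (uE.nonneg x) (uE.le_one x)) μ fun y => ?_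
            refine UnitMeasurable.integral_mono (UnitMeasurable.left
              (f := fun (q : (Fin a → Ω) × Ω) z =>
                (∏ i, W (q.1 i) q.2) * W q.2 z * (∏ i, W z (q.1 i))) uP0 (x, y))
              (UnitMeasurable.left (f := fun (x : Fin a → Ω) z => ∏ i, W z (x i)) uv x) μ
              fun z => ?_
            exact mul_le_of_le_one_left (uv.nonneg (x, z))
              ((UnitMeasurable.mul (uu.comp measurable_fst)
                (h.unit.kernel_comp (f := fun p : ((Fin a → Ω) × Ω) × Ω => p.1.2) (g := Prod.snd)
                  (by fun_prop) measurable_snd)).le_one ((x, y), z))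
        _ = _ := by simp
    have hd := uD.nonneg x
    have he := uE.nonneg x
    have hp := uP.nonneg x
    have hK := uK.nonneg x
    set P := ∫ y, ∫ z, (∏ i, W (x i) y) * W y z * (∏ i, W z (x i)) ∂μ ∂μ
    set D := ∫ y, ∏ i, W (x i) y ∂μ
    set E := ∫ z, ∏ i, W z (x i) ∂μ
    set K := ∫ y : Fin (b + 1) → Ω, ∫ z : Fin (c + 1) → Ω,
        bipWeight W x y * bipWeight W y z * bipWeight W z x
        ∂Measure.pi (fun _ => μ) ∂Measure.pi (fun _ => μ)
    -- AM-GM needs `D` and `E` positive; otherwise `P ≤ D` and `P ≤ E` force `P = 0`.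
    by_cases h0 : D = 0 ∨ E = 0
    · have : P = 0 := by rcases h0 with h0 | h0 <;> linarith
      rw [this]
      have : 0 ≤ 2 ^ N * K + (b * c * 4 ^ a * (D * E) + (c * 2 ^ a * D + b * 2 ^ a * E)) := by
        positivity
      linarith
    · push Not at h0
      have hd' : 0 < D := lt_of_le_of_ne hd h0.1.symm
      have he' : 0 < E := lt_of_le_of_ne he h0.2.symm
      have := amgm_of_pow_le (b := b) (c := c) (p := 2 * 4 ^ a * P) (d := 2 ^ a * D)
        (e := 2 ^ a * E) (K := 2 ^ N * K) (by positivity) (by positivity) (by positivity)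
        (by positivity) (by
          have h4 : (4 : ℝ) ^ a = 2 ^ (2 * a) := by rw [pow_mul]; norm_num
          have := mul_le_mul_of_nonneg_left key
            (by positivity : (0 : ℝ) ≤ 2 ^ (2 * a * ((b + 1) * (c + 1)) + N))
          rw [h4]
          refine (le_of_eq ?_).trans (this.trans (le_of_eq ?_))
          · rw [hN]; ring
          · rw [hN]; ring)
      have h4 : (4 : ℝ) ^ a = 2 ^ a * 2 ^ a := by rw [← mul_pow]; norm_num
      rw [h4] at this ⊢
      linarith
  have iK := (uK.integrable (Measure.pi (fun _ => μ))).const_mul (2 ^ N)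
  have iP := ((uP.integrable (Measure.pi (fun _ => μ))).const_mul (2 * 4 ^ a)).const_mul
    (((b : ℝ) + 1) * (c + 1))
  have iDE := ((uD.mul uE).integrable (Measure.pi (fun _ => μ))).const_mul ((b : ℝ) * c * 4 ^ a)
  have iD := (uD.integrable (Measure.pi (fun _ => μ))).const_mul ((c : ℝ) * 2 ^ a)
  have iE := (uE.integrable (Measure.pi (fun _ => μ))).const_mul ((b : ℝ) * 2 ^ a)
  have hint := MeasureTheory.integral_mono iP (iK.add (iDE.add (iD.add iE))) hpt
  rw [integral_add' iK (iDE.add (iD.add iE)), integral_add' iDE (iD.add iE),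
    integral_add' iD iE] at hint
  simp only [integral_const_mul] at hint
  rw [hD, hE, hDE', ← hcyc, hP] at hint
  have h2 : (2 : ℝ) ^ a * (1 / 2) ^ a = 1 := by rw [← mul_pow]; norm_num
  rw [mul_assoc (c : ℝ), mul_assoc (b : ℝ) (2 ^ a), h2] at hint
  have h1 := h.one_le_integral_codegree_sq
  set Δ := 4 ^ a * ∫ p : Ω × Ω, codegree μ W p.1 p.2 ^ a ∂μ.prod μ with hΔ
  -- With `K` the normalised density, `hint` becomes `(b + 1) * (c + 1) * Δ ≤ K + b * c * Δ + c +
  -- b`, that is `K ≥ Δ + (b + c) * (Δ - 1)`.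
  have h3 : (0 : ℝ) ≤ (b + c) * (Δ - 1) := mul_nonneg (by positivity) (by linarith)
  have h4 : ((b : ℝ) + 1) * (c + 1) * (2 * 4 ^ a *
      ((∫ p : Ω × Ω, codegree μ W p.1 p.2 ^ a ∂μ.prod μ) / 2)) = (b + 1) * (c + 1) * Δ := by
    rw [hΔ]; ring
  have h5 : (b : ℝ) * c * 4 ^ a * (∫ p : Ω × Ω, codegree μ W p.1 p.2 ^ a ∂μ.prod μ) =
      b * c * Δ := by rw [hΔ]; ring
  rw [h4, h5] at hint
  linarith

/-- If almost all codegrees are `1 / 4`, then the kernel is constant. -/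
theorem ae_eq_half_of_integral_codegree_sq (h : IsRegularTournamentKernel μ W)
    (h16 : 16 * ∫ p : Ω × Ω, codegree μ W p.1 p.2 ^ 2 ∂μ.prod μ ≤ 1) :
    ∀ᵐ p ∂μ.prod μ, W p.1 p.2 = 1 / 2 := by
  have hint : Integrable (fun p : Ω × Ω => (4 * codegree μ W p.1 p.2 - 1) ^ 2) (μ.prod μ) := by
    have i1 := h.unit_codegree.integrable (μ.prod μ)
    have i2 := (h.unit_codegree.pow 2).integrable (μ.prod μ)
    refine (((i2.const_mul 16).sub (i1.const_mul 8)).add (integrable_const 1)).congr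
      (.of_forall fun p => ?_)
    simp only [Pi.add_apply, Pi.sub_apply]; ring
  have hz : ∫ p : Ω × Ω, (4 * codegree μ W p.1 p.2 - 1) ^ 2 ∂μ.prod μ = 0 :=
    le_antisymm (by rw [h.integral_codegree_sub_sq]; linarith)
      (integral_nonneg fun _ => sq_nonneg _)
  rw [integral_eq_zero_iff_of_nonneg (fun _ => sq_nonneg _) hint] at hz
  have hq : ∀ᵐ y ∂μ, ∀ᵐ z ∂μ, ∫ x, W x y * W x z ∂μ = 1 / 4 := by
    filter_upwards [Measure.ae_ae_of_ae_prod hz, h.integral_mul_eq_codegree] with y hy hy'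
    filter_upwards [hy] with z hz
    have h1 := (hy' z).2
    have h2 : 4 * codegree μ W y z - 1 = 0 := by simpa using hz
    linarith
  -- The function `x ↦ ∫ y in A, W x y` has mean `μ(A) / 2` by regularity and second moment `(μ(A) /
  -- 2) ^ 2` by `hq`, so its variance vanishes.
  have hrect : ∀ A, MeasurableSet A → ∀ᵐ x ∂μ, ∫ y in A, W x y ∂μ = μ.real A / 2 := by
    intro A hA
    have uA : UnitMeasurable (A.indicator (fun _ => (1 : ℝ)) : Ω → ℝ) :=
      ⟨measurable_const.indicator hA, Set.indicator_nonneg fun _ _ => zero_le_one,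
        fun y => Set.indicator_le' (fun _ _ => le_rfl) (fun _ _ => zero_le_one) y⟩
    set f : Ω → ℝ := A.indicator (fun _ => (1 : ℝ)) with hf
    have hfi : ∀ g : Ω → ℝ, ∫ y, f y * g y ∂μ = ∫ y in A, g y ∂μ := fun g => by
      rw [← integral_indicator hA]
      congr 1; ext y
      by_cases hy : y ∈ A <;> simp [hf, hy]
    have hfA : ∫ y, f y ∂μ = μ.real A := by simpa using hfi (fun _ => 1)
    have ufW : UnitMeasurable (fun p : Ω × Ω => f p.2 * W p.1 p.2) :=
      (uA.comp measurable_snd).mul h.unit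
    have uI : UnitMeasurable (fun x => ∫ y, f y * W x y ∂μ) :=
      UnitMeasurable.integral_right (f := fun x y => f y * W x y) ufW μ
    have s1 : ∫ x, ∫ y, f y * W x y ∂μ ∂μ = μ.real A / 2 := by
      rw [UnitMeasurable.integral_comm (f := fun x y => f y * W x y) ufW]
      calc _ = ∫ y, f y * (1 / 2) ∂μ := by
            refine integral_congr_ae ?_
            filter_upwards [h.regular_swap] with y hy
            rw [integral_const_mul, hy]
        _ = _ := by rw [integral_mul_const, hfA]; ring
    have s2 : ∫ x, (∫ y, f y * W x y ∂μ) ^ 2 ∂μ = (μ.real A / 2) ^ 2 := by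
      have e : ∀ x, (∫ y, f y * W x y ∂μ) ^ 2 =
          ∫ y, ∫ z, f y * W x y * (f z * W x z) ∂μ ∂μ := fun x => by
        simp_rw [integral_const_mul, integral_mul_const]; ring
      simp_rw [e]
      have hu : UnitMeasurable (fun p : Ω × Ω × Ω =>
          f p.2.1 * W p.1 p.2.1 * (f p.2.2 * W p.1 p.2.2)) :=
        ((uA.comp (by fun_prop)).mul (h.unit.kernel_comp (by fun_prop) (by fun_prop))).mul
          ((uA.comp (by fun_prop)).mul (h.unit.kernel_comp (by fun_prop) (by fun_prop)))
      rw [integral_rotate (F := fun x y z => f y * W x y * (f z * W x z)) hu]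
      calc _ = ∫ y, ∫ z, f y * (f z * (1 / 4)) ∂μ ∂μ := by
            refine integral_congr_ae ?_
            filter_upwards [hq] with y hy
            refine integral_congr_ae ?_
            filter_upwards [hy] with z hz
            rw [← hz, ← integral_const_mul, ← integral_const_mul]
            congr 1; ext x; ring
        _ = _ := by
            simp_rw [integral_const_mul, integral_mul_const, hfA]; ring
    have s3 : ∫ x, ((∫ y, f y * W x y ∂μ) - μ.real A / 2) ^ 2 ∂μ = 0 := by
      have i1 := uI.integrable μ
      have i2 := (uI.pow 2).integrable μ
      have e : ∀ x, ((∫ y, f y * W x y ∂μ) - μ.real A / 2) ^ 2 =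
          (∫ y, f y * W x y ∂μ) ^ 2 -
            (μ.real A * (∫ y, f y * W x y ∂μ) - (μ.real A / 2) ^ 2) := fun x => by ring
      have i3 : Integrable (fun x => μ.real A * (∫ y, f y * W x y ∂μ) - (μ.real A / 2) ^ 2) μ :=
        (i1.const_mul _).sub (integrable_const _)
      simp_rw [e]
      rw [integral_sub i2 i3,
        integral_sub (i1.const_mul _) (integrable_const _), integral_const_mul, s1, s2]
      simp only [integral_const, probReal_univ, one_smul]
      ring
    rw [integral_eq_zero_iff_of_nonneg (fun _ => sq_nonneg _)] at s3
    · filter_upwards [s3] with x hx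
      have : (∫ y, f y * W x y ∂μ) - μ.real A / 2 = 0 := by simpa using hx
      rw [← hfi]; linarith
    · have i1 := uI.integrable μ
      have i2 := (uI.pow 2).integrable μ
      refine ((i2.sub (i1.const_mul (μ.real A))).add (integrable_const ((μ.real A / 2) ^ 2))).congr
        (.of_forall fun p => ?_)
      simp only [Pi.add_apply, Pi.sub_apply]; ring
  have hm : Measurable (fun p : Ω × Ω => ENNReal.ofReal (2 * W p.1 p.2)) :=
    (h.unit.measurable.const_mul 2).ennreal_ofReal
  -- The measure with density `2 * W` agrees with the product measure on rectangles, hence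
  -- everywhere, and densities are unique almost everywhere.
  have hmeas : μ.prod μ = (μ.prod μ).withDensity
      (fun p : Ω × Ω => ENNReal.ofReal (2 * W p.1 p.2)) := by
    refine Measure.prod_eq fun A B hA hB => ?_
    rw [withDensity_apply _ (hA.prod hB), ← Measure.prod_restrict, lintegral_prod _ hm.aemeasurable]
    calc _ = ∫⁻ _ in A, μ B ∂μ := by
          refine lintegral_congr_ae (ae_restrict_of_ae ?_)
          filter_upwards [hrect B hB] with x hx
          rw [← ofReal_integral_eq_lintegral_ofReal]
          · rw [integral_const_mul, hx, mul_div_cancel₀ _ two_ne_zero, ofReal_measureReal]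
          · exact ((h.unit.left x).integrable _).const_mul 2
          · exact .of_forall fun y => mul_nonneg zero_le_two (h.unit.nonneg (x, y))
      _ = _ := by rw [lintegral_const, Measure.restrict_apply_univ, mul_comm]
  have hone : (μ.prod μ).withDensity (fun p : Ω × Ω => ENNReal.ofReal (2 * W p.1 p.2)) =
      (μ.prod μ).withDensity (fun _ => 1) := by rw [← hmeas]; exact withDensity_one.symm
  rw [withDensity_eq_iff_of_sigmaFinite hm.aemeasurable aemeasurable_const] at hone
  filter_upwards [hone] with p hp
  have : 2 * W p.1 p.2 = 1 := ENNReal.ofReal_eq_one.1 hp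
  linarith

end IsRegularTournamentKernel

/-! ### Combining the two reductions -/

theorem add_add_choose_two (a b c : ℕ) :
    (a + b + c).choose 2 =
      a.choose 2 + b.choose 2 + c.choose 2 + (a * b + b * c + c * a) := by
  have : ((a + b + c).choose 2 : ℚ) =
      a.choose 2 + b.choose 2 + c.choose 2 + (a * b + b * c + c * a) := by
    simp only [Nat.cast_choose_two]; push_cast; ring
  exact_mod_cast this

theorem IsRegularTournamentKernel.integral_codegree_sq_le_of_two_le
    (h : IsRegularTournamentKernel μ W) {a b c : ℕ} (ha : 2 ≤ a) (hb : 1 ≤ b) (hc : 1 ≤ c) :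
    16 * ∫ p : Ω × Ω, codegree μ W p.1 p.2 ^ 2 ∂μ.prod μ ≤
      2 ^ (a + b + c).choose 2 * cyclicIntegral μ W (transWeight W : (Fin a → Ω) → ℝ)
        (transWeight W : (Fin b → Ω) → ℝ) (transWeight W : (Fin c → Ω) → ℝ) := by
  obtain ⟨k, rfl⟩ := Nat.exists_eq_add_of_le' ha
  obtain ⟨b, rfl⟩ := Nat.exists_eq_add_of_le' hb
  obtain ⟨c, rfl⟩ := Nat.exists_eq_add_of_le' hc
  have h1 := h.integral_codegree_sq_le_cyclicIntegral k b c
  have h2 := le_cyclicIntegral_transWeight_transWeight_transWeight (μ := μ) h.unit h.add_swap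
    (k + 2) (b + 1) (c + 1)
  rw [add_add_choose_two, pow_add]
  set n := (k + 2).choose 2 + (b + 1).choose 2 + (c + 1).choose 2
  set N := (k + 2) * (b + 1) + (b + 1) * (c + 1) + (c + 1) * (k + 2)
  refine h1.trans ?_
  have h3 := mul_le_mul_of_nonneg_left h2 (by positivity : (0 : ℝ) ≤ 2 ^ n * 2 ^ N)
  refine le_trans (le_of_eq ?_) h3
  have : (2 : ℝ) ^ n * (1 / 2) ^ n = 1 := by rw [← mul_pow]; norm_num
  rw [mul_right_comm, ← mul_assoc, this, one_mul, mul_comm]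

theorem IsRegularTournamentKernel.integral_codegree_sq_le
    (h : IsRegularTournamentKernel μ W) {a b c : ℕ} (ha : 1 ≤ a) (hb : 1 ≤ b) (hc : 1 ≤ c)
    (habc : 4 ≤ a + b + c) :
    16 * ∫ p : Ω × Ω, codegree μ W p.1 p.2 ^ 2 ∂μ.prod μ ≤
      2 ^ (a + b + c).choose 2 * cyclicIntegral μ W (transWeight W : (Fin a → Ω) → ℝ)
        (transWeight W : (Fin b → Ω) → ℝ) (transWeight W : (Fin c → Ω) → ℝ) := by
  have ht : ∀ k : ℕ, UnitMeasurable (transWeight W : (Fin k → Ω) → ℝ) :=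
    fun _ => h.unit.comp_transWeight
  -- Rotation brings a part with at least two vertices to the front.
  rcases (by omega : 2 ≤ a ∨ 2 ≤ b ∨ 2 ≤ c) with h2 | h2 | h2
  · exact h.integral_codegree_sq_le_of_two_le h2 hb hc
  · rw [cyclicIntegral_rotate h.unit (ht a) (ht b) (ht c), add_assoc, add_comm]
    exact h.integral_codegree_sq_le_of_two_le h2 hc ha
  · rw [← cyclicIntegral_rotate h.unit (ht c) (ht a) (ht b), add_comm, ← add_assoc]
    exact h.integral_codegree_sq_le_of_two_le h2 ha hb

/-! ### Homomorphism densities -/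

theorem integral_pi_sum {ι ι' : Type*} [Fintype ι] [Fintype ι'] {F : (ι ⊕ ι' → Ω) → ℝ}
    (hF : UnitMeasurable F) :
    ∫ x, F x ∂Measure.pi (fun _ => μ) = ∫ u, ∫ v, F (Sum.elim u v)
      ∂Measure.pi (fun _ => μ) ∂Measure.pi (fun _ => μ) := by
  have h := measurePreserving_sumPiEquivProdPi_symm (fun _ : ι ⊕ ι' => μ)
  have e : ∀ p : (ι → Ω) × (ι' → Ω),
      (MeasurableEquiv.sumPiEquivProdPi (fun _ : ι ⊕ ι' => Ω)).symm p = Sum.elim p.1 p.2 :=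
    fun p => by ext i; cases i <;> rfl
  rw [← h.integral_comp', integral_prod]
  · simp_rw [e]
  · exact (hF.comp (MeasurableEquiv.sumPiEquivProdPi (fun _ => Ω)).symm.measurable).integrable _

open Classical in
theorem prod_cyclicBlowupTournament {Ω : Type*} (W : Ω → Ω → ℝ) {a b c : ℕ} (x : Fin a → Ω)
    (y : Fin b → Ω) (z : Fin c → Ω) :
    ∏ e ∈ (Finset.univ : Finset ((Fin a ⊕ Fin b ⊕ Fin c) × (Fin a ⊕ Fin b ⊕ Fin c))).filter
        (fun e => (cyclicBlowupTournament a b c).Adj e.1 e.2),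
      W (Sum.elim x (Sum.elim y z) e.1) (Sum.elim x (Sum.elim y z) e.2) =
    transWeight W x * transWeight W y * transWeight W z *
      (bipWeight W x y * bipWeight W y z * bipWeight W z x) := by
  have ht : ∀ {k : ℕ} (x : Fin k → Ω), transWeight W x =
      ∏ i, ∏ j, if i < j then W (x i) (x j) else 1 := fun x => by
    refine Finset.prod_congr rfl fun i _ => ?_
    rw [← Finset.prod_filter]
    congr 1; ext j; simp
  rw [Finset.prod_filter, Fintype.prod_prod_type]
  simp only [Fintype.prod_sum_type, cyclicBlowupTournament, Digraph.sup_adj, cyclicBlowup,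
    transitiveParts, Sum.elim_inl, Sum.elim_inr, false_or, or_false, if_true, if_false,
    Finset.prod_const_one, mul_one, one_mul, Finset.prod_mul_distrib, ht, bipWeight]
  ring_nf

namespace Tournamenton

/-- Evaluation at two distinct vertices is measure preserving onto the square. A loop would instead
sample the diagonal, a null set, hence the hypothesis `hH`. -/
theorem homDensity_congr {V : Type*} [Fintype V] {H : Digraph V} (hH : ∀ v, ¬ H.Adj v v)
    {W W' : Tournamenton} (h : ∀ᵐ p : unitInterval × unitInterval, W p.1 p.2 = W' p.1 p.2) :
    W.homDensity H = W'.homDensity H := by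
  classical
  refine integral_congr_ae ?_
  have : ∀ᵐ x : V → unitInterval, ∀ e : V × V, H.Adj e.1 e.2 →
      W (x e.1) (x e.2) = W' (x e.1) (x e.2) := by
    refine ae_all_iff.2 fun e => ?_
    by_cases he : H.Adj e.1 e.2
    · have hne : e.1 ≠ e.2 := fun h' => hH _ (h' ▸ he)
      have hind : ProbabilityTheory.IndepFun (fun x : V → unitInterval => x e.1) (fun x => x e.2)
          (Measure.pi fun _ => volume) := (ProbabilityTheory.iIndepFun_pi (X := fun _ : V => id)
        (μ := fun _ : V => (volume : Measure unitInterval))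
        fun _ => aemeasurable_id).indepFun hne
      rw [ProbabilityTheory.indepFun_iff_map_prod_eq_prod_map_map
        (measurable_pi_apply e.1).aemeasurable (measurable_pi_apply e.2).aemeasurable] at hind
      have hmp : MeasurePreserving (fun x : V → unitInterval => (x e.1, x e.2))
          (Measure.pi fun _ => volume) volume := by
        refine ⟨by fun_prop, ?_⟩
        have e1 := (measurePreserving_eval (fun _ : V => (volume : Measure unitInterval)) e.1).map_eq
        have e2 := (measurePreserving_eval (fun _ : V => (volume : Measure unitInterval)) e.2).map_eq
        rw [hind]
        exact congrArg₂ Measure.prod e1 e2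
      filter_upwards [hmp.quasiMeasurePreserving.ae h] with x hx _ using hx
    · exact .of_forall fun _ h' => absurd h' he
  filter_upwards [this] with x hx
  exact Finset.prod_congr rfl fun e he => hx e (Finset.mem_filter.1 he).2

theorem exists_measurable (W : Tournamenton) : ∃ W' : Tournamenton,
    Measurable (fun p : unitInterval × unitInterval => W' p.1 p.2) ∧
      ∀ᵐ p : unitInterval × unitInterval, W p.1 p.2 = W' p.1 p.2 := by
  set g := W.aemeasurable'.mk _
  have hg : Measurable g := W.aemeasurable'.measurable_mk
  -- Averaging the measurable representative with one minus its transpose restores the tournament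
  -- identity; truncation to `[0,1]` commutes with `t ↦ 1 - t`, so the identity survives at every
  -- point.
  set f : unitInterval × unitInterval → ℝ := fun p => max 0 (min 1 ((1 + (g p - g p.swap)) / 2))
  have hf : Measurable f := measurable_const.max (measurable_const.min
    (((hg.sub (hg.comp measurable_swap)).const_add 1).div_const 2))
  refine ⟨⟨fun x y => f (x, y), hf.aemeasurable, fun x y => ⟨le_max_left _ _,
    max_le zero_le_one (min_le_left _ _)⟩, fun x y => ?_⟩, hf, ?_⟩
  · simp only [f, Prod.swap_prod_mk]
    rcases le_total (g (x, y) - g (y, x)) (-1) with h1 | h1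
    · rw [min_eq_right (by linarith), min_eq_left (by linarith), max_eq_left (by linarith),
        max_eq_right zero_le_one]; ring
    · rcases le_total (g (x, y) - g (y, x)) 1 with h2 | h2
      · rw [min_eq_right (by linarith), min_eq_right (by linarith), max_eq_right (by linarith),
          max_eq_right (by linarith)]; ring
      · rw [min_eq_left (by linarith), min_eq_right (by linarith), max_eq_right zero_le_one,
          max_eq_left (by linarith)]; ring
  · have h1 := W.aemeasurable'.ae_eq_mk
    have h2 := (Measure.measurePreserving_swap (μ := (volume : Measure unitInterval))
      (ν := (volume : Measure unitInterval))).quasiMeasurePreserving.ae h1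
    filter_upwards [h1, h2] with p hp hp'
    change W p.1 p.2 = g p at hp
    change W p.2 p.1 = g p.swap at hp'
    have h3 := W.add_swap' p.1 p.2
    have h4 := W.mem_Icc' p.1 p.2
    have h5 : (1 + (g p - g p.swap)) / 2 = W p.1 p.2 := by rw [← hp, ← hp']; linarith
    change _ = max 0 (min 1 ((1 + (g p - g p.swap)) / 2))
    rw [h5, min_eq_right h4.2, max_eq_right h4.1]

theorem IsRegular.congr {W W' : Tournamenton} (hW : W.IsRegular)
    (h : ∀ᵐ p : unitInterval × unitInterval, W p.1 p.2 = W' p.1 p.2) : W'.IsRegular := by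
  have h' := Measure.ae_ae_of_ae_prod h
  filter_upwards [hW, h'] with x hx hx'
  rw [← hx]
  exact integral_congr_ae (hx'.mono fun _ h => h.symm)

theorem unitMeasurable {W : Tournamenton}
    (hm : Measurable (fun p : unitInterval × unitInterval => W p.1 p.2)) :
    UnitMeasurable (fun p : unitInterval × unitInterval => W p.1 p.2) :=
  ⟨hm, fun p => (W.mem_Icc' p.1 p.2).1, fun p => (W.mem_Icc' p.1 p.2).2⟩

theorem homDensity_eq_cyclicIntegral {W : Tournamenton}
    (hm : Measurable (fun p : unitInterval × unitInterval => W p.1 p.2)) (a b c : ℕ) :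
    W.homDensity (cyclicBlowupTournament a b c) =
      cyclicIntegral volume W (transWeight W : (Fin a → unitInterval) → ℝ)
        (transWeight W : (Fin b → unitInterval) → ℝ)
        (transWeight W : (Fin c → unitInterval) → ℝ) := by
  classical
  have hu : UnitMeasurable (fun x : Fin a ⊕ Fin b ⊕ Fin c → unitInterval =>
      ∏ e ∈ (Finset.univ : Finset ((Fin a ⊕ Fin b ⊕ Fin c) × (Fin a ⊕ Fin b ⊕ Fin c))).filter
        (fun e => (cyclicBlowupTournament a b c).Adj e.1 e.2),
        W (x e.1) (x e.2)) :=
    .prod fun _ => (unitMeasurable hm).kernel_comp (by fun_prop) (by fun_prop)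
  rw [homDensity, volume_pi, integral_pi_sum (by convert hu), cyclicIntegral]
  congr 1; ext x
  rw [integral_pi_sum]
  · simp_rw [← prod_cyclicBlowupTournament]
  · refine UnitMeasurable.comp (g := fun v => Sum.elim x v) (by convert hu) ?_
    exact measurable_pi_iff.2 fun i => by
      cases i with
      | inl => simp
      | inr => simp only [Sum.elim_inr]; fun_prop

theorem not_adj_self (a b c : ℕ) (v : Fin a ⊕ Fin b ⊕ Fin c) :
    ¬ (cyclicBlowupTournament a b c).Adj v v := by
  rcases v with i | i | i <;> simp [cyclicBlowupTournament, cyclicBlowup, transitiveParts]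

/-- The constant tournamenton. -/
noncomputable def half : Tournamenton where
  toFun _ _ := 1 / 2
  aemeasurable' := aemeasurable_const
  mem_Icc' _ _ := by constructor <;> norm_num
  add_swap' _ _ := by norm_num

theorem homDensity_half (a b c : ℕ) :
    half.homDensity (cyclicBlowupTournament a b c) = 1 / 2 ^ (a + b + c).choose 2 := by
  have ht : ∀ (k : ℕ) (x : Fin k → unitInterval), transWeight half x = (1 / 2) ^ k.choose 2 := by
    intro k
    induction k with
    | zero => intro x; simp [transWeight]
    | succ k ih =>
      intro x
      rw [← Fin.cons_self_tail x, transWeight_cons, ih, Nat.choose_succ_succ' k 1,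
        Nat.choose_one_right, pow_add]
      simp [half]
  have hb : ∀ (k l : ℕ) (x : Fin k → unitInterval) (y : Fin l → unitInterval),
      bipWeight half x y = (1 / 2) ^ (k * l) := by
    intro k l x y
    simp [bipWeight, half, pow_mul']
  rw [homDensity_eq_cyclicIntegral (W := half) measurable_const, cyclicIntegral]
  simp_rw [ht, hb]
  simp only [integral_const, probReal_univ, one_smul]
  rw [add_add_choose_two, ← one_div_pow]
  ring_nf

end Tournamenton

/-! ### The theorem for tournamentons -/

theorem mainTheorem3 (a b c : ℕ) (ha : 1 ≤ a) (hb : 1 ≤ b) (hc : 1 ≤ c) (habc : 4 ≤ a + b + c)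
    (W : Tournamenton) (hW : W.IsRegular) :
    W.homDensity (cyclicBlowupTournament a b c) ≥ 1 / 2 ^ ((a + b + c).choose 2) ∧
      (W.homDensity (cyclicBlowupTournament a b c) = 1 / 2 ^ ((a + b + c).choose 2) ↔
        ∀ᵐ p : unitInterval × unitInterval, W p.1 p.2 = 1 / 2) := by
  obtain ⟨W', hm, hae⟩ := W.exists_measurable
  have h : IsRegularTournamentKernel (volume : Measure unitInterval) W' :=
    ⟨Tournamenton.unitMeasurable hm, W'.add_swap', hW.congr hae⟩
  have key := h.integral_codegree_sq_le ha hb hc habc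
  rw [← Tournamenton.homDensity_eq_cyclicIntegral hm,
    ← Tournamenton.homDensity_congr (Tournamenton.not_adj_self a b c) hae] at key
  have h1 := h.one_le_integral_codegree_sq
  have hpos : (0 : ℝ) < 2 ^ (a + b + c).choose 2 := by positivity
  refine ⟨?_, fun heq => ?_, fun hhalf => ?_⟩
  · rw [ge_iff_le, div_le_iff₀ hpos]
    linarith
  -- At equality `key` says that `16` times the second moment of the codegree is at most `1`, its
  -- least possible value.
  · rw [heq, mul_one_div_cancel hpos.ne'] at key
    filter_upwards [hae, h.ae_eq_half_of_integral_codegree_sq key] with p hp hp'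
    rw [hp, hp']
  · rw [Tournamenton.homDensity_congr (W' := .half) (Tournamenton.not_adj_self a b c) hhalf,
      Tournamenton.homDensity_half]
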